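/- Let $A=F(G)$ be the algebra of functions on a finite quantum group $G$: a finite-dimensional unital $\mathrm{C}^*$-algebra which is a Hopf algebra over $\mathbb{C}$ whose comultiplication $\Delta:A\to A\otimes A$ is a $*$-homomorphism, where $(a\otimes b)^*=a^*\otimes b^*$; write $\varepsilon$ for the counit. A Haar state is a positive functional $h$ on $A$ with $h(\mathds{1}_G)=1$ and $(I\otimes h)\Delta(a)=h(a)\mathds{1}_G=(h\otimes I)\Delta(a)$ for all $a\in A$. There is exactly one Haar state; denote it by $\int_G$. Let $F(\widehat G)$ be the space of linear functionals on $A$, with the convolution $\varphi_1\star\varphi_2=(\varphi_1\otimes\varphi_2)\Delta$. Every $\varphi\in F(\widehat G)$ has exactly one density, i.e. an element $a_\varphi\in A$ with $\varphi(b)=\int_G a_\varphi b$ for all $b\in A$. Put $\widehat h(\varphi)=\varepsilon(a_\varphi)$. A representation of $G$ on a complex vector space $V$ is a linear map $\kappa:V\to V\otimes A$ with $(\kappa\otimes I_A)\kappa=(I_V\otimes\Delta)\kappa$ and $(I_V\otimes\varepsilon)\kappa=I_V$. It is irreducible if $V\neq 0$ and the only subspaces $W\subseteq V$ with $\kappa(W)\subseteq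 W\otimes A$ are $0$ and $V$. On an inner product space $V$ it is unitary if $\langle\kappa(v),\kappa(w)\rangle=\langle v,w\rangle\mathds{1}_G$ for all $v,w\in V$, where $\langle v\otimes a,w\otimes b\rangle=\langle v,w\rangle\,a^*b$. Two representations are equivalent if some linear isomorphism of the underlying spaces intertwines them. Let $(\kappa_\alpha)_{\alpha\in\operatorname{Irr}(G)}$ be any complete family of pairwise inequivalent irreducible unitary representations on finite-dimensional inner product spaces $V_\alpha$, and let $d_\alpha=\dim V_\alpha$. Let $\overline{V_\alpha}$ be the conjugate vector space of $V_\alpha$, and let the conjugate $\overline{\kappa_\alpha}:\overline{V_\alpha}\to\overline{V_\alpha}\otimes A$ be given by $\overline{\kappa_\alpha}(\overline v)=\sum_i\overline{v_i}\otimes a_i^*$ if $\kappa_\alpha(v)=\sum_i v_i\otimes a_i$. The Fourier transform of $a_\varphi$ at $\alpha$ is the operator $\widehat{a_\varphi}(\alpha)=(I_{\overline{V_\alpha}}\otimes\varphi)\circ\overline{\kappa_\alpha}$ on $\overline{V_\alpha}$. Then $\operatorname{Irr}(G)$ is finite, and for all $\varphi_1,\varphi_2\in F(\widehat G)$ $$\widehat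 h(\varphi_1\star\varphi_2)=\sum_{\alpha\in\operatorname{Irr}(G)}d_\alpha\operatorname{Tr}\left(\widehat{a_{\varphi_1}}(\alpha)\,\widehat{a_{\varphi_2}}(\alpha)\right).$$ -/

import Mathlib

open scoped TensorProduct ComplexOrder

/-- The algebra of functions `A = F(G)` on a finite quantum group `G`: a finite-dimensional unital
C⋆-algebra which is a Hopf algebra (for the same algebra structure over `ℂ`) and whose
comultiplication `Δ : A → A ⊗ A` is a ⋆-homomorphism. The involution of `A ⊗ A` is
`(a ⊗ b)⋆ = a⋆ ⊗ b⋆`; multiplicativity of `Δ` is part of `HopfAlgebra`. -/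
class FiniteQuantumGroup (A : Type*) extends CStarAlgebra A, HopfAlgebra ℂ A where
  finiteDimensional : FiniteDimensional ℂ A
  comul_star : ∀ a : A,
    (Coalgebra.comul (R := ℂ) (Star.star a) : A ⊗[ℂ] A) =
      Star.star (Coalgebra.comul (R := ℂ) a : A ⊗[ℂ] A)

namespace FiniteQuantumGroup

noncomputable section

/-! ### The Haar state, densities, and the dual quantum group -/

section Haar

variable (A : Type*) [FiniteQuantumGroup A]

variable {A} in
/-- `h` is a Haar state: positive, normalised and invariant,
`(id ⊗ h) Δ(a) = h(a) 1 = (h ⊗ id) Δ(a)`. -/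
structure IsHaarState (h : Module.Dual ℂ A) : Prop where
  nonneg : ∀ a : A, 0 ≤ h (star a * a)
  map_one : h 1 = 1
  right_invariant : ∀ a : A,
    TensorProduct.rid ℂ A (h.lTensor A (Coalgebra.comul a)) = h a • (1 : A)
  left_invariant : ∀ a : A,
    TensorProduct.lid ℂ A (h.rTensor A (Coalgebra.comul a)) = h a • (1 : A)

/-- The Haar state of `G`, chosen by its defining property. -/
def haarState : Module.Dual ℂ A :=
  Classical.epsilon fun h : Module.Dual ℂ A => IsHaarState h

variable {A}

/-- `a` is the density of `φ` with respect to the Haar state: `φ(b) = ∫_G a b` for all `b`. -/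
def IsDensity (φ : Module.Dual ℂ A) (a : A) : Prop :=
  ∀ b : A, φ b = haarState A (a * b)

/-- The density `a_φ` of the functional `φ`, chosen by its defining property. -/
def density (φ : Module.Dual ℂ A) : A :=
  Classical.epsilon fun a : A => IsDensity φ a

/-- The convolution `φ₁ ⋆ φ₂ = (φ₁ ⊗ φ₂) ∘ Δ`, the multiplication of the dual `F(Ĝ)`. -/
def convolution (φ₁ φ₂ : Module.Dual ℂ A) : Module.Dual ℂ A :=
  TensorProduct.lid ℂ ℂ ∘ₗ TensorProduct.map φ₁ φ₂ ∘ₗ Coalgebra.comul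

/-- The functional `ĥ(φ) = ε(a_φ)` on the dual `F(Ĝ)`. -/
def dualHaar (φ : Module.Dual ℂ A) : ℂ :=
  Coalgebra.counit (R := ℂ) (density φ)

end Haar

/-! ### The conjugate vector space -/

/-- The conjugate vector space `V̄` of a complex vector space: the same additive group, with the
scalar action `c • v̄ = overline (c̄ • v)`. -/
structure ConjSpace (V : Type*) where
  bar ::
  unbar : V

namespace ConjSpace

variable {V : Type*} [AddCommGroup V]

/-- The canonical bijection `v ↦ v̄`. -/
def equiv (V : Type*) : ConjSpace V ≃ V where
  toFun := unbar
  invFun := bar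

instance : AddCommGroup (ConjSpace V) := (equiv V).addCommGroup

variable [Module ℂ V]

instance : Module ℂ (ConjSpace V) where
  smul c x := bar (star c • x.unbar)
  one_smul x := congrArg bar (by simp)
  mul_smul c d x := congrArg bar (by simp [mul_smul]; rfl)
  smul_zero c := congrArg bar (smul_zero (star c))
  smul_add c x y := congrArg bar (smul_add (star c) x.unbar y.unbar)
  add_smul c d x := congrArg bar (by simp [add_smul]; rfl)
  zero_smul x := congrArg bar (by simp)

/-- The canonical conjugate-linear isomorphism `v ↦ v̄`. -/
def conjₗ (V : Type*) [AddCommGroup V] [Module ℂ V] : V ≃ₛₗ[starRingEnd ℂ] ConjSpace V where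
  toFun := bar
  invFun := unbar
  map_add' _ _ := rfl
  map_smul' c v := congrArg bar (by simp)

end ConjSpace

/-! ### Corepresentations -/

/-- A (co)representation of `G` on `V`: a linear map `κ : V → V ⊗ F(G)` with
`(κ ⊗ id) κ = (id ⊗ Δ) κ` and `(id ⊗ ε) κ = id`. -/
structure Corep (A : Type*) [FiniteQuantumGroup A] (V : Type*) [AddCommGroup V] [Module ℂ V] where
  toLin : V →ₗ[ℂ] V ⊗[ℂ] A
  coassoc : TensorProduct.assoc ℂ V A A ∘ₗ toLin.rTensor A ∘ₗ toLin =
    (Coalgebra.comul (R := ℂ) (A := A)).lTensor V ∘ₗ toLin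
  counital : TensorProduct.rid ℂ V ∘ₗ (Coalgebra.counit (R := ℂ) (A := A)).lTensor V ∘ₗ toLin =
    LinearMap.id

namespace Corep

section Algebraic

variable {A : Type*} [FiniteQuantumGroup A]
variable {V : Type*} [AddCommGroup V] [Module ℂ V] {W : Type*} [AddCommGroup W] [Module ℂ W]

/-- A subspace `W` of `V` is invariant if `κ(W) ⊆ W ⊗ F(G)`. -/
def IsInvariant (κ : Corep A V) (W : Submodule ℂ V) : Prop :=
  ∀ w ∈ W, κ.toLin w ∈ LinearMap.range (W.subtype.rTensor A)

/-- Irreducibility: `V ≠ 0`, and the only invariant subspaces are `0` and `V`. -/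
def IsIrreducible (κ : Corep A V) : Prop :=
  Nontrivial V ∧ ∀ W : Submodule ℂ V, κ.IsInvariant W → W = ⊥ ∨ W = ⊤

/-- Equivalence: there is a linear isomorphism which intertwines the two corepresentations. -/
def Equivalent (κ : Corep A V) (π : Corep A W) : Prop :=
  ∃ T : V ≃ₗ[ℂ] W, T.toLinearMap.rTensor A ∘ₗ κ.toLin = π.toLin ∘ₗ T.toLinearMap

/-- The underlying map `κ̄ : V̄ → V̄ ⊗ F(G)` of the conjugate: if `κ(v) = ∑ vᵢ ⊗ aᵢ`, then
`κ̄(v̄) = ∑ v̄ᵢ ⊗ aᵢ⋆`. -/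
def conj (κ : Corep A V) : ConjSpace V →ₗ[ℂ] ConjSpace V ⊗[ℂ] A :=
  ((TensorProduct.map (ConjSpace.conjₗ V).toLinearMap (starLinearEquiv ℂ (A := A)).toLinearMap).comp
    κ.toLin).comp (ConjSpace.conjₗ V).symm.toLinearMap

/-- The Fourier transform of `a_φ` at the representation `κ`,
`(id ⊗ φ) ∘ κ̄`, a linear operator on `V̄`. -/
def fourier (κ : Corep A V) (φ : Module.Dual ℂ A) : Module.End ℂ (ConjSpace V) :=
  TensorProduct.rid ℂ (ConjSpace V) ∘ₗ φ.lTensor (ConjSpace V) ∘ₗ κ.conj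

end Algebraic

section Unitary

variable {A : Type*} [FiniteQuantumGroup A]
variable {V : Type*} [NormedAddCommGroup V] [InnerProductSpace ℂ V]

/-- The `F(G)`-valued sesquilinear pairing on `V ⊗ F(G)`,
`⟨v ⊗ a, w ⊗ b⟩ = ⟨v, w⟩ a⋆ b`, conjugate-linear in the first variable. -/
def pairing (A : Type*) [FiniteQuantumGroup A]
    (V : Type*) [NormedAddCommGroup V] [InnerProductSpace ℂ V] :
    V ⊗[ℂ] A →ₛₗ[starRingEnd ℂ] V ⊗[ℂ] A →ₗ[ℂ] A :=
  TensorProduct.lift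
    (LinearMap.mk₂'ₛₗ (starRingEnd ℂ) (starRingEnd ℂ)
      (fun v a => TensorProduct.lid ℂ A ∘ₗ
        TensorProduct.map (innerₛₗ ℂ v) (LinearMap.mulLeft ℂ (star a)))
      (fun v v' a => by ext; simp [TensorProduct.add_tmul])
      (fun c v a => by ext; simp [mul_smul])
      (fun v a a' => by ext; simp [add_mul, smul_add])
      (fun c v a => by ext; simp))

/-- Unitarity: `⟨κ(v), κ(w)⟩ = ⟨v, w⟩ 1` for all `v, w`. -/
def IsUnitary (κ : Corep A V) : Prop :=
  ∀ v w : V, pairing A V (κ.toLin v) (κ.toLin w) = inner ℂ v w • (1 : A)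

end Unitary

/-- `κ` is a complete family of pairwise inequivalent irreducible unitary representations, i.e.
its index set serves as `Irr(G)`. Since every finite-dimensional inner product space is
isometric to some `ℂⁿ`, completeness needs to be asked only for representations on `ℂⁿ`. -/
structure IsIrrFamily {A : Type*} [FiniteQuantumGroup A] {ι : Type*} {V : ι → Type*}
    [∀ α, NormedAddCommGroup (V α)] [∀ α, InnerProductSpace ℂ (V α)]
    (κ : ∀ α, Corep A (V α)) : Prop where
  irreducible : ∀ α, (κ α).IsIrreducible
  unitary : ∀ α, (κ α).IsUnitary
  inequivalent : ∀ α β, (κ α).Equivalent (κ β) → α = β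
  complete : ∀ (n : ℕ) (π : Corep A (EuclideanSpace ℂ (Fin n))),
    π.IsIrreducible → π.IsUnitary → ∃ α, π.Equivalent (κ α)

end Corep

end

end FiniteQuantumGroup

/-! Write h for the Haar state and ψ = φ₁ ⋆ φ₂. If η satisfies ε(a) = h(a η) for all a, then ĥ(ψ) =
ε(a_ψ) = h(a_ψ η) = ψ(η). The claim is that η = ∑ d_α χ_α⋆. For matrix coefficients u one has Δ((u i
i)⋆) = ∑ j, (u i j)⋆ ⊗ (u j i)⋆, so ψ(χ_α⋆) is the trace of the product of the two Fourier
transforms (`trace_fourier_comp_fourier`).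

The claim (`IsIrrFamily.haarState_mul_sum_character`) holds on matrix coefficients by Schur
orthogonality. This suffices because the coefficients are total
(`IsIrrFamily.eq_zero_of_orthogonal`): their orthogonal complement is invariant under Δ, so if
nonzero it contains an irreducible piece, whose elements are combinations of coefficients and hence
orthogonal to themselves.

All this rests on identifying h with the normalised trace τ of left multiplication, which is
positive, faithful and tracial. Bijectivity of the Galois map gives (τ ⊗ τ)Δ = τ, and an L² argument
upgrades this idempotence to invariance. Traciality is why the Schur relations contain no modular
matrix. -/

namespace FiniteQuantumGroup

noncomputable section

/-! ### Slice maps -/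

section Slices

variable {V W A B : Type*} [AddCommGroup V] [Module ℂ V] [AddCommGroup W] [Module ℂ W]
  [AddCommGroup A] [Module ℂ A] [AddCommGroup B] [Module ℂ B]

/-- The slice map `id ⊗ φ`. -/
def sliceRight (V : Type*) [AddCommGroup V] [Module ℂ V] (φ : Module.Dual ℂ A) :
    V ⊗[ℂ] A →ₗ[ℂ] V :=
  TensorProduct.rid ℂ V ∘ₗ φ.lTensor V

/-- The slice map `f ⊗ id`. -/
def sliceLeft (A : Type*) [AddCommGroup A] [Module ℂ A] (f : Module.Dual ℂ V) :
    V ⊗[ℂ] A →ₗ[ℂ] A :=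
  TensorProduct.lid ℂ A ∘ₗ f.rTensor A

@[simp]
theorem sliceRight_tmul (φ : Module.Dual ℂ A) (v : V) (a : A) :
    sliceRight V φ (v ⊗ₜ a) = φ a • v := by
  simp [sliceRight]

@[simp]
theorem sliceLeft_tmul (f : Module.Dual ℂ V) (v : V) (a : A) :
    sliceLeft A f (v ⊗ₜ a) = f v • a := by
  simp [sliceLeft]

theorem apply_sliceRight (f : Module.Dual ℂ V) (φ : Module.Dual ℂ A) (x : V ⊗[ℂ] A) :
    f (sliceRight V φ x) = φ (sliceLeft A f x) := by
  induction x with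
  | zero => simp
  | tmul v a => simp [mul_comm]
  | add x y hx hy => simp [hx, hy]

theorem sliceRight_rTensor (φ : Module.Dual ℂ A) (T : V →ₗ[ℂ] W) (x : V ⊗[ℂ] A) :
    sliceRight W φ (T.rTensor A x) = T (sliceRight V φ x) := by
  induction x with
  | zero => simp
  | tmul v a => simp
  | add x y hx hy => simp [hx, hy]

/-- Right slices separate the points of `V ⊗ A`. -/
theorem eq_of_forall_sliceRight_eq [FiniteDimensional ℂ A] {x y : V ⊗[ℂ] A}
    (h : ∀ φ : Module.Dual ℂ A, sliceRight V φ x = sliceRight V φ y) : x = y := by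
  let b := Module.finBasis ℂ A
  apply (TensorProduct.equivFinsuppOfBasisRight (M := V) b).injective
  ext i
  rw [TensorProduct.equivFinsuppOfBasisRight_apply, TensorProduct.equivFinsuppOfBasisRight_apply]
  exact h (b.coord i)

end Slices

/-! ### The Haar state as normalised trace; densities -/

section HaarState

variable {A : Type*} [FiniteQuantumGroup A]

instance : FiniteDimensional ℂ A := finiteDimensional

instance : Nontrivial A :=
  ⟨⟨0, 1, fun h => by simpa using congrArg (Coalgebra.counit (R := ℂ)) h⟩⟩

variable (A) in
/-- The normalised trace of the left regular representation. -/
def normTrace : Module.Dual ℂ A :=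
  (Module.finrank ℂ A : ℂ)⁻¹ • (LinearMap.trace ℂ A ∘ₗ LinearMap.mul ℂ A)

theorem finrank_ne_zero : (Module.finrank ℂ A : ℂ) ≠ 0 := by
  exact_mod_cast (Module.finrank_pos (R := ℂ) (M := A)).ne'

theorem normTrace_apply (a : A) :
    normTrace A a = (Module.finrank ℂ A : ℂ)⁻¹ * LinearMap.trace ℂ A (LinearMap.mulLeft ℂ a) :=
  rfl

theorem normTrace_one : normTrace A 1 = 1 := by
  rw [normTrace_apply, LinearMap.mulLeft_one, LinearMap.trace_id, inv_mul_cancel₀ finrank_ne_zero]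

theorem normTrace_mul_comm (a b : A) : normTrace A (a * b) = normTrace A (b * a) := by
  rw [normTrace_apply, normTrace_apply, LinearMap.mulLeft_mul, LinearMap.mulLeft_mul,
    ← Module.End.mul_eq_comp, ← Module.End.mul_eq_comp, LinearMap.trace_mul_comm]

/-- Eigenvalues of left multiplication by x lie in the spectrum of x, and C⋆-positivity applies to x
= a⋆a. -/
theorem nonneg_of_isRoot_charpoly_mulLeft (a : A) {z : ℂ}
    (hz : z ∈ (LinearMap.mulLeft ℂ (star a * a)).charpoly.roots) : 0 ≤ z := by
  have h1 : Module.End.HasEigenvalue (LinearMap.mulLeft ℂ (star a * a)) z :=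
    (Module.End.hasEigenvalue_iff_isRoot_charpoly _ _).2 (Polynomial.isRoot_of_mem_roots hz)
  have h2 : z ∈ spectrum ℂ (star a * a) :=
    AlgHom.spectrum_apply_subset (Algebra.lmul ℂ A) _ h1.mem_spectrum
  rw [← (IsSelfAdjoint.star_mul_self a).spectrumRestricts.algebraMap_image] at h2
  obtain ⟨r, hr, rfl⟩ := h2
  have := spectrum_star_mul_self_nonneg r hr
  simpa using this

theorem normTrace_star_mul_self_nonneg (a : A) : 0 ≤ normTrace A (star a * a) := by
  rw [normTrace_apply,
    Module.End.trace_eq_sum_roots_charpoly_of_splits (IsAlgClosed.splits _)]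
  refine mul_nonneg (inv_nonneg.2 (Nat.cast_nonneg _)) (Multiset.sum_nonneg ?_)
  exact fun z hz => nonneg_of_isRoot_charpoly_mulLeft a hz

theorem eq_zero_of_normTrace_star_mul_self_eq_zero {a : A} (h : normTrace A (star a * a) = 0) :
    a = 0 := by
  rw [normTrace_apply, mul_eq_zero, or_iff_right (inv_ne_zero finrank_ne_zero),
    Module.End.trace_eq_sum_roots_charpoly_of_splits (IsAlgClosed.splits _)] at h
  have h0 : ∀ z ∈ (LinearMap.mulLeft ℂ (star a * a)).charpoly.roots, z = 0 :=
    Multiset.all_zero_of_le_zero_le_of_sum_eq_zero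
      (fun z hz => nonneg_of_isRoot_charpoly_mulLeft a hz) h
  -- All roots vanish, so the characteristic polynomial is X^m; Cayley–Hamilton makes a⋆a nilpotent.
  have h1 := (IsAlgClosed.splits (LinearMap.mulLeft ℂ (star a * a)).charpoly).eq_prod_roots
  rw [Multiset.eq_replicate_card.2 h0, (LinearMap.charpoly_monic _).leadingCoeff] at h1
  have h2 := LinearMap.aeval_self_charpoly (LinearMap.mulLeft ℂ (star a * a))
  rw [h1] at h2
  simp only [map_one, Multiset.map_replicate, map_zero, sub_zero, Multiset.prod_replicate, one_mul,
    map_pow, Polynomial.aeval_X, LinearMap.pow_mulLeft] at h2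
  have h3 := LinearMap.congr_fun h2 1
  simp only [LinearMap.mulLeft_apply, mul_one, LinearMap.zero_apply] at h3
  set m := Multiset.card (LinearMap.mulLeft ℂ (star a * a)).charpoly.roots
  -- For self-adjoint x, ‖x^(2^m)‖ = ‖x‖^(2^m); since m ≤ 2^m the left side is zero.
  have h4 := (IsSelfAdjoint.star_mul_self a).nnnorm_pow_two_pow m
  rw [pow_eq_zero_of_le m.lt_two_pow_self.le h3, nnnorm_zero, eq_comm] at h4
  exact (CStarRing.star_mul_self_eq_zero_iff a).1 (nnnorm_eq_zero.1 (eq_zero_of_pow_eq_zero h4))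

/-- The Galois map `y ⊗ x ↦ Δ(y) (1 ⊗ x)`. -/
def galoisMap : A ⊗[ℂ] A →ₗ[ℂ] A ⊗[ℂ] A :=
  (LinearMap.mul' ℂ A).lTensor A ∘ₗ (TensorProduct.assoc ℂ A A A).toLinearMap ∘ₗ
    (Coalgebra.comul (R := ℂ) (A := A)).rTensor A

theorem galoisMap_tmul (y x : A) :
    galoisMap (y ⊗ₜ[ℂ] x) = Coalgebra.comul (R := ℂ) y * (1 ⊗ₜ[ℂ] x) := by
  let 𝓡 := Coalgebra.Repr.arbitrary ℂ y
  simp only [galoisMap, LinearMap.comp_apply, LinearMap.rTensor_tmul, ← 𝓡.eq]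
  simp [TensorProduct.sum_tmul, Finset.sum_mul]

theorem galoisMap_surjective : Function.Surjective (galoisMap (A := A)) := by
  rw [← LinearMap.range_eq_top, eq_top_iff, ← TensorProduct.span_tmul_eq_top, Submodule.span_le]
  rintro _ ⟨a, x, rfl⟩
  -- The preimage is a₁ ⊗ S(a₂)x, since a₁ ⊗ a₂S(a₃)x = a ⊗ x.
  refine ⟨(LinearMap.mulRight ℂ x ∘ₗ HopfAlgebra.antipode ℂ).lTensor A (Coalgebra.comul a), ?_⟩
  let F : A ⊗[ℂ] (A ⊗[ℂ] A) →ₗ[ℂ] A ⊗[ℂ] A :=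
    (LinearMap.mulRight ℂ x ∘ₗ LinearMap.mul' ℂ A ∘ₗ
      (HopfAlgebra.antipode ℂ (A := A)).lTensor A).lTensor A
  have hF : ∀ z : A ⊗[ℂ] A, galoisMap ((LinearMap.mulRight ℂ x ∘ₗ
      HopfAlgebra.antipode ℂ).lTensor A z) =
      F (TensorProduct.assoc ℂ A A A (Coalgebra.comul.rTensor A z)) := by
    intro z
    induction z with
    | zero => simp
    | add y z hy hz => simp only [map_add, hy, hz]
    | tmul y z =>
      simp only [LinearMap.lTensor_tmul, LinearMap.comp_apply, galoisMap, LinearMap.rTensor_tmul,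
        F, LinearEquiv.coe_coe]
      induction (Coalgebra.comul (R := ℂ) y) with
      | zero => simp
      | add y z hy hz => simp only [map_add, TensorProduct.add_tmul, hy, hz]
      | tmul y z => simp [mul_assoc]
  rw [hF, Coalgebra.coassoc_apply, ← LinearMap.comp_apply, ← LinearMap.lTensor_comp,
    LinearMap.comp_assoc, LinearMap.comp_assoc, HopfAlgebra.mul_antipode_lTensor_comul]
  rw [LinearMap.lTensor_comp_apply, LinearMap.lTensor_comp_apply, Coalgebra.lTensor_counit_comul]
  simp

theorem galoisMap_mul (a : A) (x : A ⊗[ℂ] A) :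
    galoisMap ((LinearMap.mulLeft ℂ a).rTensor A x) = Coalgebra.comul (R := ℂ) a * galoisMap x := by
  induction x with
  | zero => simp
  | add y z hy hz => simp only [map_add, hy, hz, mul_add]
  | tmul y z => simp [galoisMap_tmul, mul_assoc]

theorem trace_mulLeft_tensor (x : A ⊗[ℂ] A) :
    LinearMap.trace ℂ (A ⊗[ℂ] A) (LinearMap.mulLeft ℂ x) =
      (Module.finrank ℂ A : ℂ) ^ 2 *
        LinearMap.mul' ℂ ℂ (TensorProduct.map (normTrace A) (normTrace A) x) := by
  have hn := finrank_ne_zero (A := A)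
  induction x with
  | zero => simp
  | add y z hy hz =>
    have : LinearMap.mulLeft ℂ (y + z) = LinearMap.mulLeft ℂ y + LinearMap.mulLeft ℂ z := by
      ext; simp [add_mul]
    rw [this, map_add, hy, hz, map_add, map_add, mul_add]
  | tmul y z =>
    have : LinearMap.mulLeft ℂ (y ⊗ₜ[ℂ] z) =
        TensorProduct.map (LinearMap.mulLeft ℂ y) (LinearMap.mulLeft ℂ z) := by
      ext; simp
    rw [this, LinearMap.trace_tensorProduct']
    simp only [TensorProduct.map_tmul, LinearMap.mul'_apply, normTrace_apply]
    field_simp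

/-- The normalised trace is idempotent for the convolution. -/
theorem normTrace_comul (a : A) :
    LinearMap.mul' ℂ ℂ (TensorProduct.map (normTrace A) (normTrace A) (Coalgebra.comul a)) =
      normTrace A a := by
  have hn := finrank_ne_zero (A := A)
  let e : A ⊗[ℂ] A ≃ₗ[ℂ] A ⊗[ℂ] A := LinearEquiv.ofBijective galoisMap
    ⟨LinearMap.injective_iff_surjective.2 galoisMap_surjective, galoisMap_surjective⟩
  have h1 : LinearMap.mulLeft ℂ (Coalgebra.comul (R := ℂ) a) =
      e.conj ((LinearMap.mulLeft ℂ a).rTensor A) := by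
    refine LinearMap.ext fun x => ?_
    obtain ⟨x, rfl⟩ := e.surjective x
    have he : ∀ x, e x = galoisMap x := fun _ => rfl
    rw [LinearEquiv.conj_apply_apply, LinearEquiv.symm_apply_apply, he, he, galoisMap_mul]
    rfl
  -- With n = dim A, the trace of multiplication by Δ(a) is n²(τ ⊗ τ)Δ(a); conjugation by the Galois
  -- map shows it is also n · tr(L_a) = n² τ(a).
  have h2 := trace_mulLeft_tensor (Coalgebra.comul (R := ℂ) a)
  rw [h1, LinearMap.trace_conj', LinearMap.rTensor, LinearMap.trace_tensorProduct',
    LinearMap.trace_id] at h2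
  rw [normTrace_apply]
  apply mul_left_cancel₀ (pow_ne_zero 2 hn)
  rw [← h2]
  field_simp

/-- Polarisation: positivity at a + 1 and a + i·1 controls the imaginary and real parts
respectively. -/
theorem map_star_of_nonneg {h : Module.Dual ℂ A} (hh : ∀ a, 0 ≤ h (star a * a)) (a : A) :
    h (star a) = star (h a) := by
  have h0 := (Complex.nonneg_iff.1 (hh a)).2
  have h1 := (Complex.nonneg_iff.1 (hh 1)).2
  have h2 := (Complex.nonneg_iff.1 (hh (a + 1))).2
  have h3 := (Complex.nonneg_iff.1 (hh (a + Complex.I • 1))).2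
  simp only [star_add, star_one, mul_add, add_mul, one_mul, mul_one, map_add, Complex.add_im,
    star_smul, smul_mul_assoc, mul_smul_comm, map_smul, smul_eq_mul, Complex.star_def,
    Complex.conj_I, Complex.mul_im, Complex.I_re, Complex.I_im, Complex.neg_re, Complex.neg_im,
    Complex.mul_re] at h0 h1 h2 h3
  apply Complex.ext
  · rw [Complex.star_def, Complex.conj_re]
    linarith
  · rw [Complex.star_def, Complex.conj_im]
    linarith

theorem normTrace_star (a : A) : normTrace A (star a) = star (normTrace A a) :=
  map_star_of_nonneg normTrace_star_mul_self_nonneg a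

/-- The inner product defined by the normalised trace. -/
abbrev normTraceCore (W : Submodule ℂ A) : InnerProductSpace.Core ℂ W where
  inner a b := normTrace A (star (a : A) * b)
  conj_inner_symm a b := by
    rw [starRingEnd_apply, ← normTrace_star, star_mul, star_star]
  re_inner_nonneg a := (Complex.nonneg_iff.1 (normTrace_star_mul_self_nonneg (a : A))).1
  add_left a b c := by simp [add_mul]
  smul_left a b r := by simp
  definite a h := Subtype.ext (eq_zero_of_normTrace_star_mul_self_eq_zero h)

theorem exists_basis_of_core {W : Type*} [AddCommGroup W] [Module ℂ W] [FiniteDimensional ℂ W]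
    (c : InnerProductSpace.Core ℂ W) : ∃ b : Module.Basis (Fin (Module.finrank ℂ W)) ℂ W,
      ∀ i j, c.inner (b i) (b j) = if i = j then 1 else 0 := by
  let : NormedAddCommGroup W := c.toNormedAddCommGroup
  let : InnerProductSpace ℂ W := InnerProductSpace.ofCore c.toCore
  let b := stdOrthonormalBasis ℂ W
  refine ⟨b.toBasis, fun i j => ?_⟩
  rw [OrthonormalBasis.coe_toBasis]
  exact orthonormal_iff_ite.1 b.orthonormal i j

/-- Every subspace of `A` has a basis which is orthonormal for the normalised trace. -/
theorem exists_orthonormal_basis (W : Submodule ℂ A) :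
    ∃ b : Module.Basis (Fin (Module.finrank ℂ W)) ℂ W,
      ∀ i j, normTrace A (star (b i : A) * b j) = if i = j then 1 else 0 :=
  exists_basis_of_core (normTraceCore W)

/-- The functional `τ ⊗ τ` on `A ⊗ A`, for the normalised trace `τ`. -/
def normTrace₂ : Module.Dual ℂ (A ⊗[ℂ] A) :=
  LinearMap.mul' ℂ ℂ ∘ₗ TensorProduct.map (normTrace A) (normTrace A)

theorem normTrace₂_tmul (a b : A) :
    normTrace₂ (a ⊗ₜ[ℂ] b) = normTrace A a * normTrace A b := rfl

/-- Expanding x = ∑ bᵢ ⊗ yᵢ over a τ-orthonormal basis turns the value into ∑ τ(yᵢ⋆yᵢ), reducing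
faithfulness of τ ⊗ τ to that of τ. -/
theorem eq_zero_of_normTrace₂_star_mul_self_eq_zero {x : A ⊗[ℂ] A}
    (h : normTrace₂ (star x * x) = 0) : x = 0 := by
  obtain ⟨b₀, hb₀⟩ := exists_orthonormal_basis (⊤ : Submodule ℂ A)
  let b := b₀.map Submodule.topEquiv
  have hb : ∀ i j, normTrace A (star (b i) * b j) = if i = j then 1 else 0 := hb₀
  obtain ⟨y, rfl⟩ : ∃ y : Fin _ → A, x = ∑ i, b i ⊗ₜ[ℂ] y i := by
    obtain ⟨c, rfl⟩ := TensorProduct.eq_repr_basis_left b x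
    exact ⟨c, Finsupp.sum_fintype _ _ fun i => TensorProduct.tmul_zero _ _⟩
  have h1 : normTrace₂ (star (∑ i, b i ⊗ₜ[ℂ] y i) * (∑ i, b i ⊗ₜ[ℂ] y i)) =
      ∑ i, normTrace A (star (y i) * y i) := by
    simp [star_sum, Finset.sum_mul, Finset.mul_sum, normTrace₂_tmul, hb]
  rw [h1, Finset.sum_eq_zero_iff_of_nonneg
    (fun i _ => normTrace_star_mul_self_nonneg (y i))] at h
  refine Finset.sum_eq_zero fun i hi => ?_
  rw [eq_zero_of_normTrace_star_mul_self_eq_zero (h i hi), TensorProduct.tmul_zero]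

theorem sliceRight_star {φ : Module.Dual ℂ A} (hφ : ∀ a, φ (star a) = star (φ a))
    (x : A ⊗[ℂ] A) : sliceRight A φ (star x) = star (sliceRight A φ x) := by
  induction x with
  | zero => simp
  | add y z hy hz => simp [hy, hz]
  | tmul y z => simp [hφ]

theorem sliceLeft_star {φ : Module.Dual ℂ A} (hφ : ∀ a, φ (star a) = star (φ a))
    (x : A ⊗[ℂ] A) : sliceLeft A φ (star x) = star (sliceLeft A φ x) := by
  induction x with
  | zero => simp
  | add y z hy hz => simp [hy, hz]
  | tmul y z => simp [hφ]

theorem eq_of_normTrace₂ {u v : A ⊗[ℂ] A} {r : ℂ} (h1 : normTrace₂ (star u * u) = r)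
    (h2 : normTrace₂ (star u * v) = r) (h3 : normTrace₂ (star v * u) = r)
    (h4 : normTrace₂ (star v * v) = r) : u = v := by
  refine sub_eq_zero.1 (eq_zero_of_normTrace₂_star_mul_self_eq_zero ?_)
  simp [sub_mul, mul_sub, h1, h2, h3, h4]

/-- By coassociativity, applying E = (id ⊗ τ)Δ twice is slicing by τ ⋆ τ, which equals τ. -/
theorem sliceRight_normTrace_comul_idem (a : A) :
    sliceRight A (normTrace A) (Coalgebra.comul (sliceRight A (normTrace A) (Coalgebra.comul a))) =
      sliceRight A (normTrace A) (Coalgebra.comul a) := by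
  have key : ∀ x : A ⊗[ℂ] A,
      sliceRight A (normTrace A) (Coalgebra.comul (sliceRight A (normTrace A) x)) =
      sliceRight A normTrace₂ (TensorProduct.assoc ℂ A A A (Coalgebra.comul.rTensor A x)) := by
    intro x
    induction x with
    | zero => simp
    | add y z hy hz => simp only [map_add, hy, hz]
    | tmul y z =>
      simp only [sliceRight_tmul, map_smul, LinearMap.rTensor_tmul]
      induction (Coalgebra.comul (R := ℂ) y) with
      | zero => simp
      | add y z hy hz => simp only [map_add, TensorProduct.add_tmul, smul_add, hy, hz]
      | tmul y w => simp [normTrace₂_tmul, smul_smul, mul_comm]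
  rw [key, Coalgebra.coassoc_apply]
  induction (Coalgebra.comul (R := ℂ) a) with
  | zero => simp
  | add y z hy hz => simp only [map_add, hy, hz]
  | tmul y z =>
    rw [LinearMap.lTensor_tmul, sliceRight_tmul, sliceRight_tmul]
    exact congrArg (· • y) (normTrace_comul z)

theorem sliceLeft_normTrace_comul_idem (a : A) :
    sliceLeft A (normTrace A) (Coalgebra.comul (sliceLeft A (normTrace A) (Coalgebra.comul a))) =
      sliceLeft A (normTrace A) (Coalgebra.comul a) := by
  have key : ∀ x : A ⊗[ℂ] A,
      sliceLeft A (normTrace A) (Coalgebra.comul (sliceLeft A (normTrace A) x)) =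
      sliceLeft A normTrace₂
        ((TensorProduct.assoc ℂ A A A).symm (Coalgebra.comul.lTensor A x)) := by
    intro x
    induction x with
    | zero => simp
    | add y z hy hz => simp only [map_add, hy, hz]
    | tmul y z =>
      simp only [sliceLeft_tmul, map_smul, LinearMap.lTensor_tmul]
      induction (Coalgebra.comul (R := ℂ) z) with
      | zero => simp
      | add y z hy hz => simp only [map_add, TensorProduct.tmul_add, smul_add, hy, hz]
      | tmul z w => simp [normTrace₂_tmul, smul_smul]
  rw [key, Coalgebra.coassoc_symm_apply]
  induction (Coalgebra.comul (R := ℂ) a) with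
  | zero => simp
  | add y z hy hz => simp only [map_add, hy, hz]
  | tmul y z =>
    rw [LinearMap.rTensor_tmul, sliceLeft_tmul, sliceLeft_tmul]
    exact congrArg (· • z) (normTrace_comul y)

theorem normTrace₂_tmul_one_mul (c : A) (x : A ⊗[ℂ] A) :
    normTrace₂ ((c ⊗ₜ[ℂ] 1) * x) = normTrace A (c * sliceRight A (normTrace A) x) := by
  induction x with
  | zero => simp
  | add y z hy hz => simp only [map_add, mul_add, hy, hz]
  | tmul y z => simp [normTrace₂_tmul, mul_comm]

theorem normTrace₂_one_tmul_mul (c : A) (x : A ⊗[ℂ] A) :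
    normTrace₂ ((1 ⊗ₜ[ℂ] c) * x) = normTrace A (c * sliceLeft A (normTrace A) x) := by
  induction x with
  | zero => simp
  | add y z hy hz => simp only [map_add, mul_add, hy, hz]
  | tmul y z => simp [normTrace₂_tmul]

theorem normTrace₂_mul_comm (x y : A ⊗[ℂ] A) : normTrace₂ (x * y) = normTrace₂ (y * x) := by
  induction x with
  | zero => simp
  | add y z hy hz => simp only [map_add, mul_add, add_mul, hy, hz]
  | tmul a b =>
    induction y with
    | zero => simp
    | add y z hy hz => simp only [map_add, mul_add, add_mul, hy, hz]
    | tmul c d =>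
      simp only [Algebra.TensorProduct.tmul_mul_tmul, normTrace₂_tmul]
      rw [normTrace_mul_comm a c, normTrace_mul_comm b d]

theorem normTrace₂_comul (a : A) : normTrace₂ (Coalgebra.comul (R := ℂ) a) = normTrace A a :=
  normTrace_comul a

/-- For b in the range of E = (id ⊗ τ)Δ, the L² distance from Δ(b) to b ⊗ 1 vanishes: all four inner
products equal τ(b⋆b), by τ ⋆ τ = τ and by E fixing b and b⋆. -/
theorem sliceRight_normTrace_comul (a : A) :
    sliceRight A (normTrace A) (Coalgebra.comul a) = normTrace A a • (1 : A) := by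
  set b := sliceRight A (normTrace A) (Coalgebra.comul a) with hb
  have hbb : sliceRight A (normTrace A) (Coalgebra.comul b) = b :=
    sliceRight_normTrace_comul_idem a
  have hbs : sliceRight A (normTrace A) (Coalgebra.comul (star b)) = star b := by
    rw [comul_star, sliceRight_star normTrace_star, hbb]
  have h : Coalgebra.comul (R := ℂ) b = b ⊗ₜ[ℂ] (1 : A) := by
    apply eq_of_normTrace₂ (r := normTrace A (star b * b))
    · rw [← comul_star, ← Bialgebra.comul_mul, normTrace₂_comul]
    · rw [← comul_star, normTrace₂_mul_comm, normTrace₂_tmul_one_mul, hbs, normTrace_mul_comm]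
    · rw [TensorProduct.star_tmul, star_one, normTrace₂_tmul_one_mul, hbb]
    · rw [TensorProduct.star_tmul, star_one, normTrace₂_tmul_one_mul]
      simp [normTrace_one]
  -- Applying ε to the first leg of Δ(b) = b ⊗ 1 shows b = ε(b)1; applying τ then identifies the
  -- scalar as τ(a).
  have h1 := Coalgebra.rTensor_counit_comul (R := ℂ) b
  rw [h, LinearMap.rTensor_tmul] at h1
  have h2 := congrArg (TensorProduct.lid ℂ A) h1
  rw [TensorProduct.lid_tmul, TensorProduct.lid_tmul, one_smul] at h2
  have h3 := normTrace₂_tmul_one_mul (1 : A) (Coalgebra.comul (R := ℂ) a)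
  rw [← Algebra.TensorProduct.one_def, one_mul, one_mul, ← hb, ← h2, normTrace₂_comul, map_smul,
    normTrace_one, smul_eq_mul, mul_one] at h3
  rw [h3, h2]

theorem sliceLeft_normTrace_comul (a : A) :
    sliceLeft A (normTrace A) (Coalgebra.comul a) = normTrace A a • (1 : A) := by
  set b := sliceLeft A (normTrace A) (Coalgebra.comul a) with hb
  have hbb : sliceLeft A (normTrace A) (Coalgebra.comul b) = b :=
    sliceLeft_normTrace_comul_idem a
  have hbs : sliceLeft A (normTrace A) (Coalgebra.comul (star b)) = star b := by
    rw [comul_star, sliceLeft_star normTrace_star, hbb]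
  have h : Coalgebra.comul (R := ℂ) b = (1 : A) ⊗ₜ[ℂ] b := by
    apply eq_of_normTrace₂ (r := normTrace A (star b * b))
    · rw [← comul_star, ← Bialgebra.comul_mul, normTrace₂_comul]
    · rw [← comul_star, normTrace₂_mul_comm, normTrace₂_one_tmul_mul, hbs, normTrace_mul_comm]
    · rw [TensorProduct.star_tmul, star_one, normTrace₂_one_tmul_mul, hbb]
    · rw [TensorProduct.star_tmul, star_one, normTrace₂_one_tmul_mul]
      simp [normTrace_one]
  have h1 := Coalgebra.lTensor_counit_comul (R := ℂ) b
  rw [h, LinearMap.lTensor_tmul] at h1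
  have h2 := congrArg (TensorProduct.rid ℂ A) h1
  rw [TensorProduct.rid_tmul, TensorProduct.rid_tmul, one_smul] at h2
  have h3 := normTrace₂_one_tmul_mul (1 : A) (Coalgebra.comul (R := ℂ) a)
  rw [← Algebra.TensorProduct.one_def, one_mul, one_mul, ← hb, ← h2, normTrace₂_comul, map_smul,
    normTrace_one, smul_eq_mul, mul_one] at h3
  rw [h3, h2]

theorem isHaarState_normTrace : IsHaarState (normTrace A) where
  nonneg := normTrace_star_mul_self_nonneg
  map_one := normTrace_one
  right_invariant := sliceRight_normTrace_comul
  left_invariant := sliceLeft_normTrace_comul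

/-- Evaluate (k ⊗ h)Δ(a) in the two possible orders. -/
theorem IsHaarState.eq {h k : Module.Dual ℂ A} (hh : IsHaarState h) (hk : IsHaarState k) :
    h = k := by
  ext a
  have h1 : k (sliceRight A h (Coalgebra.comul a)) = k (h a • (1 : A)) :=
    congrArg k (hh.right_invariant a)
  have h2 : h (sliceLeft A k (Coalgebra.comul a)) = h (k a • (1 : A)) :=
    congrArg h (hk.left_invariant a)
  rw [apply_sliceRight, h2] at h1
  simpa [hh.map_one, hk.map_one] using h1.symm

theorem existsUnique_isHaarState : ∃! h : Module.Dual ℂ A, IsHaarState h :=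
  ⟨normTrace A, isHaarState_normTrace, fun _ hk => hk.eq isHaarState_normTrace⟩

variable (A) in
theorem isHaarState_haarState : IsHaarState (haarState A) :=
  Classical.epsilon_spec (p := fun h : Module.Dual ℂ A => IsHaarState h)
    ⟨_, isHaarState_normTrace⟩

variable (A) in
theorem haarState_eq_normTrace : haarState A = normTrace A :=
  (isHaarState_haarState A).eq isHaarState_normTrace

theorem haarState_mul_comm (a b : A) : haarState A (a * b) = haarState A (b * a) := by
  rw [haarState_eq_normTrace, normTrace_mul_comm]

theorem eq_zero_of_haarState_star_mul_self_eq_zero {a : A} (h : haarState A (star a * a) = 0) :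
    a = 0 :=
  eq_zero_of_normTrace_star_mul_self_eq_zero (haarState_eq_normTrace A ▸ h)

/-- Faithfulness, tested at a⋆, makes a ↦ h(a ·) injective, and A and its dual have equal dimension.
-/
theorem existsUnique_isDensity (φ : Module.Dual ℂ A) : ∃! a : A, IsDensity φ a := by
  let F : A →ₗ[ℂ] Module.Dual ℂ A := (LinearMap.mul ℂ A).compr₂ (haarState A)
  have hF : Function.Injective F := by
    rw [← LinearMap.ker_eq_bot, LinearMap.ker_eq_bot']
    intro a ha
    apply star_eq_zero.1
    apply eq_zero_of_haarState_star_mul_self_eq_zero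
    rw [star_star]
    exact LinearMap.congr_fun ha (star a)
  have hs : Function.Surjective F :=
    (LinearMap.injective_iff_surjective_of_finrank_eq_finrank
      Subspace.dual_finrank_eq.symm).1 hF
  obtain ⟨a, rfl⟩ := hs φ
  exact ⟨a, fun b => rfl, fun a' h => hF (LinearMap.ext fun b => (h b).symm)⟩

theorem isDensity_density (φ : Module.Dual ℂ A) : IsDensity φ (density φ) :=
  Classical.epsilon_spec (p := fun a : A => IsDensity φ a) (existsUnique_isDensity φ).exists

end HaarState

namespace Corep

/-! ### Invariant subspaces and Schur's lemma -/

section Schur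

variable {A : Type*} [FiniteQuantumGroup A]
variable {V : Type*} [AddCommGroup V] [Module ℂ V] {W : Type*} [AddCommGroup W] [Module ℂ W]

/-- Slices separate points, so the image of κ(w) in (V/U) ⊗ A can be tested slice by slice;
exactness of the tensor product does the rest. -/
theorem isInvariant_iff (κ : Corep A V) (U : Submodule ℂ V) :
    κ.IsInvariant U ↔ ∀ φ : Module.Dual ℂ A, ∀ w ∈ U, sliceRight V φ (κ.toLin w) ∈ U := by
  constructor
  · intro h φ w hw
    obtain ⟨x, hx⟩ := h w hw
    rw [← hx, sliceRight_rTensor]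
    exact (sliceRight U φ x).2
  · intro h w hw
    refine (rTensor_exact A (LinearMap.exact_subtype_mkQ U) U.mkQ_surjective _).1 ?_
    refine eq_of_forall_sliceRight_eq fun φ => ?_
    rw [sliceRight_rTensor, map_zero, Submodule.mkQ_apply, Submodule.Quotient.mk_eq_zero]
    exact h φ w hw

/-- `T` intertwines the corepresentations `κ` and `π`. -/
def Intertwines (κ : Corep A V) (π : Corep A W) (T : V →ₗ[ℂ] W) : Prop :=
  T.rTensor A ∘ₗ κ.toLin = π.toLin ∘ₗ T

variable {κ : Corep A V} {π : Corep A W} {T : V →ₗ[ℂ] W}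

theorem Intertwines.sliceRight (hT : Intertwines κ π T) (φ : Module.Dual ℂ A) (v : V) :
    sliceRight W φ (π.toLin (T v)) = T (sliceRight V φ (κ.toLin v)) := by
  rw [← sliceRight_rTensor]
  exact congrArg _ (LinearMap.congr_fun hT v).symm

theorem Intertwines.ker (hT : Intertwines κ π T) : κ.IsInvariant (LinearMap.ker T) := by
  rw [isInvariant_iff]
  intro φ w hw
  rw [LinearMap.mem_ker] at hw ⊢
  rw [← hT.sliceRight, hw, map_zero, map_zero]

theorem Intertwines.range (hT : Intertwines κ π T) : π.IsInvariant (LinearMap.range T) := by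
  rw [isInvariant_iff]
  rintro φ _ ⟨v, rfl⟩
  exact ⟨_, (hT.sliceRight φ v).symm⟩

theorem Intertwines.eq_zero (hT : Intertwines κ π T) (hκ : κ.IsIrreducible)
    (hπ : π.IsIrreducible) (h : ¬ κ.Equivalent π) : T = 0 := by
  by_contra hT0
  have hk : LinearMap.ker T = ⊥ := (hκ.2 _ hT.ker).resolve_right
    fun hk => hT0 (LinearMap.ker_eq_top.1 hk)
  have hr : LinearMap.range T = ⊤ := (hπ.2 _ hT.range).resolve_left
    fun hr => hT0 (LinearMap.range_eq_bot.1 hr)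
  exact h ⟨LinearEquiv.ofBijective T ⟨LinearMap.ker_eq_bot.1 hk, LinearMap.range_eq_top.1 hr⟩, hT⟩

theorem Intertwines.eq_smul_id [FiniteDimensional ℂ V] {T : V →ₗ[ℂ] V} (hT : Intertwines κ κ T)
    (hκ : κ.IsIrreducible) : ∃ c : ℂ, T = c • LinearMap.id := by
  have := hκ.1
  obtain ⟨c, hc⟩ := Module.End.exists_eigenvalue T
  refine ⟨c, ?_⟩
  have hS : Intertwines κ κ (T - c • LinearMap.id) := by
    unfold Intertwines at hT ⊢
    rw [LinearMap.rTensor_sub, LinearMap.rTensor_smul, LinearMap.rTensor_id, LinearMap.sub_comp,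
      LinearMap.comp_sub, hT, LinearMap.smul_comp, LinearMap.comp_smul]
    rfl
  obtain ⟨v, hv⟩ := hc.exists_hasEigenvector
  have hk : LinearMap.ker (T - c • LinearMap.id) = ⊤ := (hκ.2 _ hS.ker).resolve_left fun hb => by
    have : v ∈ LinearMap.ker (T - c • LinearMap.id) := by simp [hv.apply_eq_smul]
    rw [hb, Submodule.mem_bot] at this
    exact hv.2 this
  exact sub_eq_zero.1 (LinearMap.ker_eq_top.1 hk)

end Schur

/-! ### Matrix coefficients -/

section Matrix

variable {A : Type*} [FiniteQuantumGroup A] {ι ι' : Type*} [Fintype ι] [DecidableEq ι]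
  [Fintype ι'] [DecidableEq ι']

/-- `u` is a unitary corepresentation matrix:
`Δ(u i j) = ∑ k, u i k ⊗ u k j`, `ε(u i j) = δ i j` and `u⋆ u = 1`. -/
structure IsUnitaryMatrix (u : ι → ι → A) : Prop where
  comul : ∀ i j, Coalgebra.comul (R := ℂ) (u i j) = ∑ k, u i k ⊗ₜ[ℂ] u k j
  counit : ∀ i j, Coalgebra.counit (R := ℂ) (u i j) = if i = j then 1 else 0
  star_mul_self : ∀ i j, ∑ k, star (u k i) * u k j = if i = j then 1 else 0

/-- A embeds in the endomorphisms of a finite-dimensional space, so one-sided inverses of matrices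
over A are two-sided. -/
theorem IsUnitaryMatrix.mul_star_self {u : ι → ι → A} (hu : IsUnitaryMatrix u) (i j : ι) :
    ∑ k, u i k * star (u j k) = if i = j then 1 else 0 := by
  have h1 : (Matrix.of fun i j => star (u j i)) * Matrix.of u = 1 := by
    ext i j
    simpa [Matrix.mul_apply, Matrix.one_apply] using hu.star_mul_self i j
  have : IsStablyFiniteRing A :=
    IsStablyFiniteRing.of_injective (Algebra.lmul ℂ A) Algebra.lmul_injective
  have h2 := mul_eq_one_comm.1 h1
  simpa [Matrix.mul_apply, Matrix.one_apply] using congrFun (congrFun h2 i) j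

/-- The matrix `h(u i j (v k l)⋆)` intertwines `v` and `u`. -/
theorem IsUnitaryMatrix.haarState_intertwines {u : ι → ι → A} {v : ι' → ι' → A}
    (hu : IsUnitaryMatrix u) (hv : IsUnitaryMatrix v) (j : ι) (l : ι') (i : ι) (r : ι') :
    ∑ k, haarState A (u i j * star (v k l)) • v k r =
      ∑ p, haarState A (u p j * star (v r l)) • u i p := by
  -- Invariance of h at u i j (v k l)⋆. Multiplying by v k r and summing over k, the relation v⋆v =
  -- 1 leaves only q = r.
  have h1 : ∀ k, haarState A (u i j * star (v k l)) • (1 : A) =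
      ∑ p, ∑ q, haarState A (u p j * star (v q l)) • (u i p * star (v k q)) := by
    intro k
    rw [← (isHaarState_haarState A).right_invariant, Bialgebra.comul_mul, comul_star, hu.comul,
      hv.comul, star_sum, Finset.sum_mul_sum, map_sum, map_sum]
    refine Finset.sum_congr rfl fun p _ => ?_
    rw [map_sum, map_sum]
    refine Finset.sum_congr rfl fun q _ => ?_
    simp
  calc ∑ k, haarState A (u i j * star (v k l)) • v k r
      = ∑ k, (haarState A (u i j * star (v k l)) • (1 : A)) * v k r := by simp
    _ = ∑ k, ∑ p, ∑ q, haarState A (u p j * star (v q l)) • (u i p * (star (v k q) * v k r)) := by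
        simp_rw [h1, Finset.sum_mul, smul_mul_assoc, mul_assoc]
    _ = ∑ p, ∑ q, ∑ k, haarState A (u p j * star (v q l)) •
          (u i p * (star (v k q) * v k r)) := by
        rw [Finset.sum_comm]
        exact Finset.sum_congr rfl fun p _ => Finset.sum_comm
    _ = ∑ p, haarState A (u p j * star (v r l)) • u i p := by
        simp_rw [← Finset.smul_sum, ← Finset.mul_sum, hv.star_mul_self]
        simp

/-- The orthogonal complement of the coefficients is invariant under Δ. Left invariance at (u i j)⋆a
gives a linear system for y = (h ⊗ id)((u⋆ ⊗ 1)Δ(a)), and uu⋆ = 1 solves it to y = 0. -/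
theorem IsUnitaryMatrix.haarState_star_mul_sliceRight_eq_zero {u : ι → ι → A} (hu : IsUnitaryMatrix u) {a : A}
    (ha : ∀ i j, haarState A (star (u i j) * a) = 0) (φ : Module.Dual ℂ A) (i j : ι) :
    haarState A (star (u i j) * sliceRight A φ (Coalgebra.comul a)) = 0 := by
  let y : ι → ι → A := fun i j =>
    sliceLeft A (haarState A) ((star (u i j) ⊗ₜ[ℂ] (1 : A)) * Coalgebra.comul a)
  have hslice : ∀ (c d : A) (x : A ⊗[ℂ] A), sliceLeft A (haarState A) ((c ⊗ₜ[ℂ] d) * x) =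
      d * sliceLeft A (haarState A) ((c ⊗ₜ[ℂ] 1) * x) := by
    intro c d x
    induction x with
    | zero => simp
    | add y z hy hz => simp only [map_add, mul_add, hy, hz]
    | tmul y z => simp
  have hy : ∀ i j, ∑ k, star (u k j) * y i k = 0 := by
    intro i j
    have h1 := (isHaarState_haarState A).left_invariant (star (u i j) * a)
    rw [ha, zero_smul, Bialgebra.comul_mul, comul_star, hu.comul, star_sum, Finset.sum_mul] at h1
    change sliceLeft A (haarState A) _ = 0 at h1
    rw [map_sum] at h1
    rw [← h1]
    exact Finset.sum_congr rfl fun k _ => by rw [TensorProduct.star_tmul, hslice]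
  have hy0 : y i j = 0 := by
    have h2 : ∑ l, u j l * ∑ k, star (u k l) * y i k = y i j := by
      simp_rw [Finset.mul_sum, ← mul_assoc]
      rw [Finset.sum_comm]
      simp_rw [← Finset.sum_mul, hu.mul_star_self]
      simp
    rw [← h2]
    simp [hy]
  have hφ : ∀ (c : A) (x : A ⊗[ℂ] A), haarState A (c * sliceRight A φ x) =
      φ (sliceLeft A (haarState A) ((c ⊗ₜ[ℂ] 1) * x)) := by
    intro c x
    induction x with
    | zero => simp
    | add y z hy hz => simp only [map_add, mul_add, hy, hz]
    | tmul y z => simp [mul_comm]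
  rw [hφ]
  exact (congrArg φ hy0).trans (map_zero φ)

end Matrix

/-! ### Coefficients of a corepresentation in a basis -/

section Coefficients

variable {A : Type*} [FiniteQuantumGroup A]
variable {V : Type*} [AddCommGroup V] [Module ℂ V] {W : Type*} [AddCommGroup W] [Module ℂ W]
variable {ι ι' : Type*}

/-- The matrix coefficients `u i j` with `κ(b j) = ∑ i, b i ⊗ u i j`. -/
def coeff (κ : Corep A V) (b : Module.Basis ι ℂ V) (i j : ι) : A :=
  sliceLeft A (b.coord i) (κ.toLin (b j))

theorem counit_coeff [DecidableEq ι] (κ : Corep A V) (b : Module.Basis ι ℂ V) (i j : ι) :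
    Coalgebra.counit (R := ℂ) (κ.coeff b i j) = if i = j then 1 else 0 := by
  have h : sliceRight V Coalgebra.counit (κ.toLin (b j)) = b j :=
    LinearMap.congr_fun κ.counital (b j)
  rw [coeff, ← apply_sliceRight, h]
  simp [Finsupp.single_apply, eq_comm]

variable [Fintype ι] [Fintype ι']

theorem _root_.FiniteQuantumGroup.sum_tmul_sliceLeft_coord (b : Module.Basis ι ℂ V)
    (x : V ⊗[ℂ] A) : ∑ i, b i ⊗ₜ[ℂ] sliceLeft A (b.coord i) x = x := by
  classical
  induction x with
  | zero => simp
  | add y z hy hz => simp only [map_add, TensorProduct.tmul_add, Finset.sum_add_distrib, hy, hz]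
  | tmul v a =>
    simp_rw [sliceLeft_tmul, Module.Basis.coord_apply, ← TensorProduct.smul_tmul]
    rw [← TensorProduct.sum_tmul, b.sum_repr]

theorem toLin_basis (κ : Corep A V) (b : Module.Basis ι ℂ V) (j : ι) :
    κ.toLin (b j) = ∑ i, b i ⊗ₜ[ℂ] κ.coeff b i j :=
  (sum_tmul_sliceLeft_coord b _).symm

theorem comul_coeff (κ : Corep A V) (b : Module.Basis ι ℂ V) (i j : ι) :
    Coalgebra.comul (R := ℂ) (κ.coeff b i j) =
      ∑ k, κ.coeff b i k ⊗ₜ[ℂ] κ.coeff b k j := by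
  classical
  have h := congrArg (sliceLeft (A ⊗[ℂ] A) (b.coord i)) (LinearMap.congr_fun κ.coassoc (b j))
  simp only [LinearMap.comp_apply, toLin_basis, map_sum, LinearMap.rTensor_tmul,
    LinearMap.lTensor_tmul, sliceLeft_tmul, LinearEquiv.coe_coe, TensorProduct.sum_tmul,
    TensorProduct.assoc_tmul] at h
  simpa [Finsupp.single_apply] using h.symm

theorem intertwines_of_coeff {κ : Corep A V} {π : Corep A W} {b : Module.Basis ι ℂ V}
    {c : Module.Basis ι' ℂ W} {X : ι' → ι → ℂ}
    (h : ∀ i r, ∑ k, X i k • κ.coeff b k r = ∑ p, X p r • π.coeff c i p) :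
    Intertwines κ π (b.constr ℂ fun k => ∑ i, X i k • c i) := by
  refine b.ext fun r => ?_
  simp only [LinearMap.comp_apply, toLin_basis, map_sum, LinearMap.rTensor_tmul,
    Module.Basis.constr_basis, map_smul]
  simp_rw [Finset.smul_sum, TensorProduct.sum_tmul, TensorProduct.smul_tmul]
  rw [Finset.sum_comm]
  simp_rw [← TensorProduct.tmul_sum, h, TensorProduct.tmul_sum, ← TensorProduct.tmul_smul]
  rw [Finset.sum_comm]

end Coefficients

/-! ### Orthogonality relations -/

section UnitaryCoefficients

variable {A : Type*} [FiniteQuantumGroup A]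
variable {V : Type*} [NormedAddCommGroup V] [InnerProductSpace ℂ V]
  {W : Type*} [NormedAddCommGroup W] [InnerProductSpace ℂ W]
variable {ι ι' : Type*} [Fintype ι] [Fintype ι'] [DecidableEq ι] [DecidableEq ι']

@[simp]
theorem pairing_tmul (v w : V) (a b : A) :
    pairing A V (v ⊗ₜ a) (w ⊗ₜ b) = inner ℂ v w • (star a * b) := by
  simp [pairing]

theorem IsUnitary.isUnitaryMatrix {κ : Corep A V} (hκ : κ.IsUnitary)
    (b : OrthonormalBasis ι ℂ V) : IsUnitaryMatrix (κ.coeff b.toBasis) where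
  comul := κ.comul_coeff b.toBasis
  counit := κ.counit_coeff b.toBasis
  star_mul_self i j := by
    have h := hκ (b.toBasis i) (b.toBasis j)
    rw [toLin_basis, toLin_basis] at h
    simpa [orthonormal_iff_ite.1 b.orthonormal] using h

/-- Orthogonality of the matrix coefficients of inequivalent corepresentations. -/
theorem haarState_coeff_mul_star_of_not_equivalent {κ : Corep A V} {π : Corep A W}
    (hκ : κ.IsIrreducible) (hπ : π.IsIrreducible) (hκu : κ.IsUnitary) (hπu : π.IsUnitary)
    (h : ¬ π.Equivalent κ) (b : OrthonormalBasis ι ℂ V) (c : OrthonormalBasis ι' ℂ W)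
    (i j : ι) (k l : ι') :
    haarState A (κ.coeff b.toBasis i j * star (π.coeff c.toBasis k l)) = 0 := by
  have hX := intertwines_of_coeff
    (X := fun i k => haarState A (κ.coeff b.toBasis i j * star (π.coeff c.toBasis k l)))
    fun i r => (hκu.isUnitaryMatrix b).haarState_intertwines (hπu.isUnitaryMatrix c) j l i r
  have h0 := LinearMap.congr_fun (hX.eq_zero hπ hκ h) (c.toBasis k)
  rw [Module.Basis.constr_basis, LinearMap.zero_apply] at h0
  simpa [Finsupp.single_apply] using congrArg (b.toBasis.coord i) h0

/-- The Schur orthogonality relations. -/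
theorem haarState_coeff_mul_star_self {κ : Corep A V} (hκ : κ.IsIrreducible) (hκu : κ.IsUnitary)
    (b : OrthonormalBasis ι ℂ V) (i j k l : ι) :
    (Module.finrank ℂ V : ℂ) *
      haarState A (κ.coeff b.toBasis i j * star (κ.coeff b.toBasis k l)) =
      if i = k ∧ j = l then 1 else 0 := by
  have : FiniteDimensional ℂ V := b.toBasis.finiteDimensional_of_finite
  have hu := hκu.isUnitaryMatrix b
  have hX := intertwines_of_coeff
    (X := fun i k => haarState A (κ.coeff b.toBasis i j * star (κ.coeff b.toBasis k l)))
    fun i r => hu.haarState_intertwines hu j l i r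
  obtain ⟨z, hz⟩ := hX.eq_smul_id hκ
  have h0 : ∀ i k, haarState A (κ.coeff b.toBasis i j * star (κ.coeff b.toBasis k l)) =
      if i = k then z else 0 := by
    intro i k
    have h0 := LinearMap.congr_fun hz (b.toBasis k)
    rw [Module.Basis.constr_basis] at h0
    simpa [Finsupp.single_apply, eq_comm] using congrArg (b.toBasis.coord i) h0
  -- The Schur scalar z is found by taking the trace; traciality of h is what brings in u⋆u = 1.
  have h1 : (Module.finrank ℂ V : ℂ) * z = if j = l then 1 else 0 := by
    calc (Module.finrank ℂ V : ℂ) * z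
        = ∑ i, haarState A (κ.coeff b.toBasis i j * star (κ.coeff b.toBasis i l)) := by
          simp [h0, Module.finrank_eq_card_basis b.toBasis]
      _ = haarState A (∑ i, star (κ.coeff b.toBasis i l) * κ.coeff b.toBasis i j) := by
          rw [map_sum]
          exact Finset.sum_congr rfl fun i _ => haarState_mul_comm _ _
      _ = if j = l then 1 else 0 := by
          rw [hu.star_mul_self]
          split_ifs with h1 h2 h2
          · exact (isHaarState_haarState A).map_one
          · exact absurd h1.symm h2
          · exact absurd h2.symm h1
          · exact map_zero _
  rw [h0]
  by_cases hik : i = k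
  · simp [hik, h1]
  · simp [hik]

end UnitaryCoefficients


/-! ### Corepresentations from unitary matrices -/

section OfMatrix

variable {A : Type*} [FiniteQuantumGroup A] {ι : Type*} [Fintype ι] [DecidableEq ι]

/-- The corepresentation `b j ↦ ∑ i, b i ⊗ u i j` defined by a corepresentation matrix. -/
def ofMatrix {V : Type*} [AddCommGroup V] [Module ℂ V] (b : Module.Basis ι ℂ V) {u : ι → ι → A}
    (hu : IsUnitaryMatrix u) : Corep A V where
  toLin := b.constr ℂ fun j => ∑ i, b i ⊗ₜ[ℂ] u i j
  coassoc := by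
    refine b.ext fun j => ?_
    simp only [LinearMap.comp_apply, Module.Basis.constr_basis, map_sum, LinearMap.rTensor_tmul,
      LinearMap.lTensor_tmul, TensorProduct.sum_tmul, LinearEquiv.coe_coe,
      TensorProduct.assoc_tmul, hu.comul, TensorProduct.tmul_sum]
    exact Finset.sum_comm
  counital := by
    refine b.ext fun j => ?_
    simp [hu.counit]

theorem ofMatrix_toLin_basis {V : Type*} [AddCommGroup V] [Module ℂ V] (b : Module.Basis ι ℂ V)
    {u : ι → ι → A} (hu : IsUnitaryMatrix u) (j : ι) :
    (ofMatrix b hu).toLin (b j) = ∑ i, b i ⊗ₜ[ℂ] u i j :=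
  b.constr_basis ℂ _ j

theorem ofMatrix_isUnitary {V : Type*} [NormedAddCommGroup V] [InnerProductSpace ℂ V]
    (b : OrthonormalBasis ι ℂ V) {u : ι → ι → A} (hu : IsUnitaryMatrix u) :
    (ofMatrix b.toBasis hu).IsUnitary := by
  have key : ((pairing A V).comp (ofMatrix b.toBasis hu).toLin).compl₂
      (ofMatrix b.toBasis hu).toLin = (innerₛₗ ℂ (E := V)).compr₂ₛₗ
        ((LinearMap.id (R := ℂ)).smulRight (1 : A)) := by
    refine b.toBasis.ext fun i => b.toBasis.ext fun j => ?_
    simp only [LinearMap.compl₂_apply, LinearMap.comp_apply, ofMatrix_toLin_basis]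
    simp [orthonormal_iff_ite.1 b.orthonormal, hu.star_mul_self]
  intro v w
  exact LinearMap.congr_fun (LinearMap.congr_fun key v) w

end OfMatrix

/-! ### The regular corepresentation on invariant subspaces -/

section Regular

variable (A : Type*) [FiniteQuantumGroup A]

/-- The regular corepresentation `Δ`. -/
def regular : Corep A A where
  toLin := Coalgebra.comul
  coassoc := Coalgebra.coassoc
  counital := by
    ext a
    simp

variable {A}

/-- The matrix of the regular corepresentation on an invariant subspace with orthonormal basis
`w`. -/
def regularCoeff {n : ℕ} (w : Fin n → A) (i j : Fin n) : A :=
  sliceLeft A (haarState A ∘ₗ LinearMap.mulLeft ℂ (star (w i))) (Coalgebra.comul (w j))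

variable {n : ℕ} {W : Submodule ℂ A} (w : Module.Basis (Fin n) ℂ W)

theorem sum_haarState_smul
    (hw : ∀ i j, haarState A (star (w i : A) * w j) = if i = j then 1 else 0)
    (x : A) (hx : x ∈ W) :
    ∑ i, haarState A (star (w i : A) * x) • (w i : A) = x := by
  obtain ⟨c, rfl⟩ : ∃ c : Fin n → ℂ, x = ∑ i, c i • (w i : A) :=
    ⟨w.repr ⟨x, hx⟩, by
      simpa only [map_sum, map_smul, Submodule.subtype_apply] using
        (congrArg W.subtype (w.sum_repr ⟨x, hx⟩)).symm⟩
  simp [Finset.mul_sum, hw]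

theorem comul_eq_sum_regularCoeff
    (hw : ∀ i j, haarState A (star (w i : A) * w j) = if i = j then 1 else 0)
    (hW : (regular A).IsInvariant W) (j : Fin n) :
    Coalgebra.comul (R := ℂ) (w j : A) =
      ∑ i, (w i : A) ⊗ₜ[ℂ] regularCoeff (fun i => (w i : A)) i j := by
  refine eq_of_forall_sliceRight_eq fun φ => ?_
  rw [← sum_haarState_smul w hw (sliceRight A φ (Coalgebra.comul (w j : A)))
    ((isInvariant_iff _ _).1 hW φ _ (w j).2), map_sum]
  refine Finset.sum_congr rfl fun i _ => ?_
  rw [sliceRight_tmul, regularCoeff, ← apply_sliceRight]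
  rfl

/-- Unitarity is left invariance of h at wᵢ⋆wⱼ; the other two identities are coassociativity and the
counit law paired with wᵢ. -/
theorem isUnitaryMatrix_regularCoeff
    (hw : ∀ i j, haarState A (star (w i : A) * w j) = if i = j then 1 else 0)
    (hW : (regular A).IsInvariant W) :
    IsUnitaryMatrix (regularCoeff fun i => (w i : A)) where
  comul i j := by
    have h := congrArg (sliceLeft (A ⊗[ℂ] A)
      (haarState A ∘ₗ LinearMap.mulLeft ℂ (star (w i : A)))) (Coalgebra.coassoc_apply (w j : A))
    simp only [comul_eq_sum_regularCoeff w hw hW, map_sum, LinearMap.rTensor_tmul,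
      LinearMap.lTensor_tmul, sliceLeft_tmul, TensorProduct.sum_tmul,
      TensorProduct.assoc_tmul] at h
    simpa [hw] using h.symm
  counit i j := by
    rw [regularCoeff, ← apply_sliceRight]
    have h : sliceRight A Coalgebra.counit (Coalgebra.comul (w j : A)) = (w j : A) := by
      rw [sliceRight, LinearMap.comp_apply, Coalgebra.lTensor_counit_comul]
      simp
    rw [h]
    exact hw i j
  star_mul_self i j := by
    have h := (isHaarState_haarState A).left_invariant (star (w i : A) * w j)
    change sliceLeft A _ _ = _ at h
    rw [Bialgebra.comul_mul, comul_star, comul_eq_sum_regularCoeff w hw hW,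
      comul_eq_sum_regularCoeff w hw hW, star_sum, Finset.sum_mul_sum, hw] at h
    simpa [hw] using h

end Regular

/-! ### Totality of the matrix coefficients -/

section Completeness

variable {A : Type*} [FiniteQuantumGroup A]

theorem sliceLeft_toLin_mem_span {V : Type*} [AddCommGroup V] [Module ℂ V] {ι : Type*} [Fintype ι]
    (κ : Corep A V) (b : Module.Basis ι ℂ V) (f : Module.Dual ℂ V) (x : V) :
    sliceLeft A f (κ.toLin x) ∈ Submodule.span ℂ (Set.range fun p : ι × ι => κ.coeff b p.1 p.2) := by
  rw [← b.sum_repr x]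
  simp only [map_sum, map_smul, toLin_basis, sliceLeft_tmul]
  exact Submodule.sum_mem _ fun j _ => Submodule.smul_mem _ _ <| Submodule.sum_mem _ fun i _ =>
    Submodule.smul_mem _ _ <| Submodule.subset_span ⟨(i, j), rfl⟩

/-- Every nonzero invariant subspace of the regular corepresentation contains a minimal one. -/
theorem exists_minimal_invariant {D : Submodule ℂ A} (hD : (regular A).IsInvariant D)
    (hD0 : D ≠ ⊥) : ∃ W ≤ D, W ≠ ⊥ ∧ (regular A).IsInvariant W ∧
      ∀ U ≤ W, (regular A).IsInvariant U → U = ⊥ ∨ U = W := by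
  obtain ⟨W, ⟨hWD, hW0, hW⟩, hmin⟩ := wellFounded_lt.has_min
    {W : Submodule ℂ A | W ≤ D ∧ W ≠ ⊥ ∧ (regular A).IsInvariant W} ⟨D, le_rfl, hD0, hD⟩
  refine ⟨W, hWD, hW0, hW, fun U hU hUi => ?_⟩
  by_contra! hc
  exact hmin U ⟨hU.trans hWD, hc.1, hUi⟩ (lt_of_le_of_ne hU hc.2)

theorem isIrreducible_ofMatrix {V : Type*} [AddCommGroup V] [Module ℂ V] {n : ℕ}
    (b : Module.Basis (Fin n) ℂ V) {W : Submodule ℂ A} (w : Module.Basis (Fin n) ℂ W)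
    (hw : ∀ i j, haarState A (star (w i : A) * w j) = if i = j then 1 else 0)
    (hW : (regular A).IsInvariant W) (hW0 : W ≠ ⊥)
    (hmin : ∀ U ≤ W, (regular A).IsInvariant U → U = ⊥ ∨ U = W) :
    (ofMatrix b (isUnitaryMatrix_regularCoeff w hw hW)).IsIrreducible := by
  set π := ofMatrix b (isUnitaryMatrix_regularCoeff w hw hW)
  let e : V ≃ₗ[ℂ] W := b.equiv w (Equiv.refl _)
  let J : V →ₗ[ℂ] A := W.subtype ∘ₗ e.toLinearMap
  have hJb : ∀ j, J (b j) = w j := fun j => by simp [J, e]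
  have hJi : Function.Injective J := W.injective_subtype.comp e.injective
  have hJr : LinearMap.range J = W := by
    rw [LinearMap.range_comp, LinearEquiv.range, Submodule.map_top, Submodule.range_subtype]
  have hJ : Intertwines π (regular A) J := by
    refine b.ext fun j => ?_
    rw [LinearMap.comp_apply, LinearMap.comp_apply, ofMatrix_toLin_basis, hJb, map_sum]
    refine Eq.trans ?_ (comul_eq_sum_regularCoeff w hw hW j).symm
    exact Finset.sum_congr rfl fun i _ => by rw [LinearMap.rTensor_tmul, hJb]
  constructor
  · have := Submodule.nontrivial_iff_ne_bot.2 hW0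
    exact e.toEquiv.nontrivial
  · intro U hU
    have hUi : (regular A).IsInvariant (U.map J) := by
      rw [isInvariant_iff] at hU ⊢
      rintro φ _ ⟨x, hx, rfl⟩
      exact ⟨_, hU φ x hx, (hJ.sliceRight φ x).symm⟩
    rcases hmin _ (LinearMap.map_le_range.trans hJr.le) hUi with h | h
    · left
      exact Submodule.map_injective_of_injective hJi (h.trans (Submodule.map_bot J).symm)
    · right
      apply Submodule.map_injective_of_injective hJi
      rw [h, Submodule.map_top, hJr]

/-- The matrix coefficients of a complete family of irreducible corepresentations are total. -/
theorem IsIrrFamily.eq_zero_of_orthogonal {Irr : Type*} {V : Irr → Type*}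
    [∀ α, NormedAddCommGroup (V α)] [∀ α, InnerProductSpace ℂ (V α)]
    {κ : ∀ α, Corep A (V α)} (hκ : IsIrrFamily κ) {ι : Irr → Type*} [∀ α, Fintype (ι α)]
    (b : ∀ α, OrthonormalBasis (ι α) ℂ (V α)) {a : A}
    (ha : ∀ α i j, haarState A (star ((κ α).coeff (b α).toBasis i j) * a) = 0) : a = 0 := by
  classical
  let D : Submodule ℂ A := ⨅ α, ⨅ i, ⨅ j,
    LinearMap.ker (haarState A ∘ₗ LinearMap.mulLeft ℂ (star ((κ α).coeff (b α).toBasis i j)))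
  have hDmem : ∀ x, x ∈ D ↔
      ∀ α i j, haarState A (star ((κ α).coeff (b α).toBasis i j) * x) = 0 := by
    intro x
    simp [D]
  by_contra ha0
  have hD0 : D ≠ ⊥ := fun h => ha0 <| (Submodule.mem_bot ℂ).1 (h ▸ (hDmem a).2 ha)
  have hD : (regular A).IsInvariant D := by
    rw [isInvariant_iff]
    intro φ x hx
    rw [hDmem] at hx ⊢
    exact fun α => ((hκ.unitary α).isUnitaryMatrix (b α)).haarState_star_mul_sliceRight_eq_zero (hx α) φ
  obtain ⟨W, hWD, hW0, hW, hmin⟩ := exists_minimal_invariant hD hD0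
  obtain ⟨w, hw⟩ := exists_orthonormal_basis W
  rw [← haarState_eq_normTrace] at hw
  let c := EuclideanSpace.basisFun (Fin (Module.finrank ℂ W)) ℂ
  obtain ⟨α, T, hT⟩ := hκ.complete _ _
    (isIrreducible_ofMatrix c.toBasis w hw hW hW0 hmin)
    (ofMatrix_isUnitary c (isUnitaryMatrix_regularCoeff w hw hW))
  set v := regularCoeff fun i => (w i : A) with hv
  -- Equivalent corepresentations have the same coefficient space, so v is orthogonal to D.
  have hvspan : ∀ i j, v i j ∈ Submodule.span ℂ
      (Set.range fun p : ι α × ι α => (κ α).coeff (b α).toBasis p.1 p.2) := by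
    intro i j
    have h1 := sliceLeft_toLin_mem_span (κ α) (b α).toBasis
      (c.toBasis.coord i ∘ₗ T.symm.toLinearMap) (T (c.toBasis j))
    have h2 := LinearMap.congr_fun hT (c.toBasis j)
    rw [LinearMap.comp_apply, LinearMap.comp_apply, ofMatrix_toLin_basis, map_sum] at h2
    rw [← LinearEquiv.coe_coe, ← h2] at h1
    simpa [Finsupp.single_apply] using h1
  have hvD : ∀ i j, ∀ x ∈ D, haarState A (star (v i j) * x) = 0 := by
    intro i j x hx
    refine Submodule.span_induction (p := fun y _ => haarState A (star y * x) = 0)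
      ?_ ?_ ?_ ?_ (hvspan i j)
    · rintro _ ⟨p, rfl⟩
      exact (hDmem x).1 hx α p.1 p.2
    · simp
    · intro y z _ _ hy hz
      rw [star_add, add_mul, map_add, hy, hz, add_zero]
    · intro r y _ hy
      rw [star_smul, smul_mul_assoc, map_smul, hy, smul_zero]
  have : Nontrivial W := Submodule.nontrivial_iff_ne_bot.2 hW0
  let j : Fin (Module.finrank ℂ W) := ⟨0, Module.finrank_pos⟩
  -- The counit law writes wⱼ in the coefficients v, while wⱼ also lies in D: it is orthogonal to
  -- itself.
  have hj : (w j : A) = ∑ i, Coalgebra.counit (R := ℂ) (w i : A) • v i j := by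
    have h1 := congrArg (TensorProduct.lid ℂ A) (Coalgebra.rTensor_counit_comul (R := ℂ) (w j : A))
    rw [comul_eq_sum_regularCoeff w hw hW] at h1
    simpa using h1.symm
  have h0 : haarState A (star (w j : A) * w j) = 0 := by
    nth_rewrite 1 [hj]
    rw [star_sum, Finset.sum_mul, map_sum]
    refine Finset.sum_eq_zero fun i _ => ?_
    rw [star_smul, smul_mul_assoc, map_smul, hvD i j _ (hWD (w j).2), smul_zero]
  rw [hw, if_pos rfl] at h0
  exact one_ne_zero h0

end Completeness

end Corep

/-- The conjugate of a basis. -/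
def ConjSpace.basis {V : Type*} [AddCommGroup V] [Module ℂ V] {ι : Type*} [Finite ι]
    (b : Module.Basis ι ℂ V) : Module.Basis ι ℂ (ConjSpace V) :=
  Module.Basis.ofEquivFun
    { toFun := fun x i => star (b.equivFun x.unbar i)
      map_add' := fun x y => by
        ext i
        exact (congrArg star (congrFun (map_add b.equivFun x.unbar y.unbar) i)).trans
          (star_add _ _)
      map_smul' := fun r x => by
        ext i
        refine (congrArg star (congrFun (map_smul b.equivFun (star r) x.unbar) i)).trans ?_
        simp
      invFun := fun f => ConjSpace.bar (b.equivFun.symm fun i => star (f i))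
      left_inv := fun x => congrArg ConjSpace.bar <| by
        simp only [star_star]
        exact b.equivFun.symm_apply_apply x.unbar
      right_inv := fun f => by simp }

theorem ConjSpace.basis_apply {V : Type*} [AddCommGroup V] [Module ℂ V] {ι : Type*} [Finite ι]
    (b : Module.Basis ι ℂ V) (i : ι) : ConjSpace.basis b i = ConjSpace.conjₗ V (b i) := by
  classical
  rw [ConjSpace.basis, Module.Basis.coe_ofEquivFun]
  change ConjSpace.bar (b.equivFun.symm fun j => star (Pi.single (M := fun _ => ℂ) i 1 j)) =
    ConjSpace.bar (b i)
  congr 1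
  rw [LinearEquiv.symm_apply_eq]
  ext j
  simp [Pi.single_apply, apply_ite, eq_comm]

namespace Corep

variable {A : Type*} [FiniteQuantumGroup A]

/-! ### Traces of Fourier transforms -/

section Trace

variable {V : Type*} [AddCommGroup V] [Module ℂ V] {ι : Type*} [Fintype ι]

theorem fourier_basis (κ : Corep A V) (b : Module.Basis ι ℂ V) (φ : Module.Dual ℂ A) (j : ι) :
    κ.fourier φ (ConjSpace.basis b j) =
      ∑ i, φ (star (κ.coeff b i j)) • ConjSpace.basis b i := by
  have h : κ.conj (ConjSpace.basis b j) =
      ∑ i, ConjSpace.basis b i ⊗ₜ[ℂ] star (κ.coeff b i j) := by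
    rw [ConjSpace.basis_apply]
    simp only [conj, LinearMap.comp_apply, LinearEquiv.coe_coe, LinearEquiv.symm_apply_apply,
      toLin_basis, map_sum, TensorProduct.map_tmul, ConjSpace.basis_apply]
    rfl
  rw [fourier, LinearMap.comp_apply, LinearMap.comp_apply, h]
  simp

theorem convolution_apply (φ₁ φ₂ : Module.Dual ℂ A) (a : A) :
    convolution φ₁ φ₂ a =
      LinearMap.mul' ℂ ℂ (TensorProduct.map φ₁ φ₂ (Coalgebra.comul a)) := by
  rw [convolution, LinearMap.comp_apply, LinearMap.comp_apply]
  induction (Coalgebra.comul (R := ℂ) a) with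
  | zero => simp
  | add y z hy hz => simp only [map_add, hy, hz]
  | tmul y z => simp

theorem trace_fourier_comp_fourier (κ : Corep A V) (b : Module.Basis ι ℂ V)
    (φ₁ φ₂ : Module.Dual ℂ A) :
    LinearMap.trace ℂ (ConjSpace V) (κ.fourier φ₁ ∘ₗ κ.fourier φ₂) =
      convolution φ₁ φ₂ (star (∑ i, κ.coeff b i i)) := by
  classical
  rw [LinearMap.trace_eq_matrix_trace ℂ (ConjSpace.basis b), Matrix.trace, star_sum, map_sum]
  refine Finset.sum_congr rfl fun i _ => ?_
  rw [convolution_apply, comul_star, comul_coeff, star_sum, Matrix.diag_apply,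
    LinearMap.toMatrix_apply, LinearMap.comp_apply, fourier_basis]
  simp [fourier_basis, Finsupp.single_apply, mul_comm]

end Trace

/-! ### Characters and the density of the counit -/

section Family

variable {Irr : Type*} {V : Irr → Type*} [∀ α, NormedAddCommGroup (V α)]
  [∀ α, InnerProductSpace ℂ (V α)] [∀ α, FiniteDimensional ℂ (V α)] {κ : ∀ α, Corep A (V α)}

/-- The character of a corepresentation. -/
def character {V : Type*} [NormedAddCommGroup V] [InnerProductSpace ℂ V] [FiniteDimensional ℂ V]
    (κ : Corep A V) : A :=
  ∑ i, κ.coeff (stdOrthonormalBasis ℂ V).toBasis i i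

theorem IsIrrFamily.haarState_coeff_mul_star_character [DecidableEq Irr] (hκ : IsIrrFamily κ)
    (α β : Irr) (i j : Fin (Module.finrank ℂ (V α))) :
    (Module.finrank ℂ (V β) : ℂ) * haarState A
      ((κ α).coeff (stdOrthonormalBasis ℂ (V α)).toBasis i j * star (character (κ β))) =
      if α = β ∧ i = j then 1 else 0 := by
  rw [character, star_sum, Finset.mul_sum, map_sum, Finset.mul_sum]
  by_cases hαβ : α = β
  · subst hαβ
    simp_rw [haarState_coeff_mul_star_self (hκ.irreducible α) (hκ.unitary α)]
    by_cases hij : i = j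
    · simp [hij]
    · simp only [true_and, hij, if_false]
      exact Finset.sum_eq_zero fun k _ => if_neg fun h => hij (h.1.trans h.2.symm)
  · simp only [hαβ, false_and, if_false]
    refine Finset.sum_eq_zero fun k _ => ?_
    rw [haarState_coeff_mul_star_of_not_equivalent (hκ.irreducible α) (hκ.irreducible β)
      (hκ.unitary α) (hκ.unitary β) fun h => hαβ (hκ.inequivalent β α h).symm, mul_zero]

/-- One diagonal coefficient per α gives a linearly independent family in A: pairing with χ_β⋆
isolates the β term. -/
theorem IsIrrFamily.finite (hκ : IsIrrFamily κ) : Finite Irr := by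
  classical
  have : ∀ α, Nontrivial (V α) := fun α => (hκ.irreducible α).1
  let i₀ : ∀ α, Fin (Module.finrank ℂ (V α)) := fun α => ⟨0, Module.finrank_pos⟩
  let x : Irr → A := fun α => (κ α).coeff (stdOrthonormalBasis ℂ (V α)).toBasis (i₀ α) (i₀ α)
  have hx : LinearIndependent ℂ x := by
    rw [linearIndependent_iff']
    intro s g hg β hβ
    have h := congrArg (fun y => (Module.finrank ℂ (V β) : ℂ) *
      haarState A (y * star (character (κ β)))) hg
    simp only [Finset.sum_mul, smul_mul_assoc, map_sum, map_smul, smul_eq_mul, zero_mul, map_zero,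
      mul_zero, Finset.mul_sum, mul_left_comm _ (g _), x,
      hκ.haarState_coeff_mul_star_character] at h
    simpa [hβ] using h
  exact hx.finite

/-- The density of the counit is `∑ α, d α • χ α⋆`. -/
theorem IsIrrFamily.haarState_mul_sum_character [Fintype Irr] (hκ : IsIrrFamily κ) (a : A) :
    haarState A (a * ∑ α, (Module.finrank ℂ (V α) : ℂ) • star (character (κ α))) =
      Coalgebra.counit (R := ℂ) a := by
  classical
  set η := ∑ α, (Module.finrank ℂ (V α) : ℂ) • star (character (κ α)) with hη
  let f : Module.Dual ℂ A := haarState A ∘ₗ LinearMap.mulRight ℂ η - Coalgebra.counit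
  obtain ⟨z, hz, -⟩ := existsUnique_isDensity f
  -- h((u i j)⋆ z⋆) is the conjugate of f(u i j), which vanishes by orthogonality; totality then
  -- applies to z⋆.
  have hz0 : star z = 0 := by
    refine hκ.eq_zero_of_orthogonal (fun α => stdOrthonormalBasis ℂ (V α)) fun α i j => ?_
    rw [← star_mul, map_star_of_nonneg (isHaarState_haarState A).nonneg, ← hz, star_eq_zero]
    simp only [f, LinearMap.sub_apply, LinearMap.comp_apply, LinearMap.mulRight_apply, hη,
      Finset.mul_sum, mul_smul_comm, map_sum, map_smul, smul_eq_mul,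
      hκ.haarState_coeff_mul_star_character, counit_coeff]
    by_cases hij : i = j <;> simp [hij]
  have h := hz a
  rw [star_eq_zero.1 hz0, zero_mul, map_zero] at h
  exact sub_eq_zero.1 h

end Family

end Corep
end

end FiniteQuantumGroup

theorem mainTheorem10 {A : Type*} [FiniteQuantumGroup A]
    {Irr : Type*} {V : Irr → Type*} [∀ α, NormedAddCommGroup (V α)]
    [∀ α, InnerProductSpace ℂ (V α)] [∀ α, FiniteDimensional ℂ (V α)]
    (κ : ∀ α, FiniteQuantumGroup.Corep A (V α))
    (hκ : FiniteQuantumGroup.Corep.IsIrrFamily κ) :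
    (∃! h : Module.Dual ℂ A, FiniteQuantumGroup.IsHaarState h) ∧
    (∀ φ : Module.Dual ℂ A, ∃! a : A, FiniteQuantumGroup.IsDensity φ a) ∧
    Finite Irr ∧
    ∀ φ₁ φ₂ : Module.Dual ℂ A,
      FiniteQuantumGroup.dualHaar (FiniteQuantumGroup.convolution φ₁ φ₂) =
        ∑ᶠ α : Irr, (Module.finrank ℂ (V α) : ℂ) *
          LinearMap.trace ℂ (FiniteQuantumGroup.ConjSpace (V α))
            ((κ α).fourier φ₁ ∘ₗ (κ α).fourier φ₂) := by
  have hfin := hκ.finite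
  refine ⟨FiniteQuantumGroup.existsUnique_isHaarState,
    FiniteQuantumGroup.existsUnique_isDensity, hfin, fun φ₁ φ₂ => ?_⟩
  have := Fintype.ofFinite Irr
  -- The chain ε(a_ψ) = h(a_ψ η) = ψ(η); finiteness of `Irr` makes the `finsum` a genuine sum.
  rw [finsum_eq_sum_of_fintype, FiniteQuantumGroup.dualHaar, ← hκ.haarState_mul_sum_character,
    ← FiniteQuantumGroup.isDensity_density, map_sum]
  refine Finset.sum_congr rfl fun α _ => ?_
  rw [map_smul, smul_eq_mul, FiniteQuantumGroup.Corep.trace_fourier_comp_fourier _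
    (stdOrthonormalBasis ℂ (V α)).toBasis]
  rfl
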